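/- For $\theta\in\Theta=(0,1]$ let $P_\theta=\mathcal U([0,\theta])^{\otimes n}$ be the law of $n\ge 1$ i.i.d. samples, uniform on $[0,\theta]$, viewed as a distribution on datasets $\mathbf X\in[0,1]^n$. The minimax quadratic risk is $$\mathfrak M_n=\inf_{\hat\theta}\ \sup_{\theta\in\Theta}\int(\hat\theta(\mathbf X)-\theta)^2\,dP_\theta(\mathbf X),$$ the infimum being over measurable $\hat\theta:[0,1]^n\to\Theta$. A randomized mechanism $M$ is a Markov kernel from $[0,1]^n$ to $\Theta$. For a privacy condition $\mathcal C$ on mechanisms, $$\mathfrak M_n(\mathcal C)=\inf_{M\text{ satisfying }\mathcal C}\ \sup_{\theta\in\Theta}\int\mathbb E\big[(M(\mathbf X)-\theta)^2\big]\,dP_\theta(\mathbf X).$$ The mechanism $M$ is $\epsilon$-DP if $\Pr(M(\mathbf X)\in S)\le e^{\epsilon}\Pr(M(\mathbf Y)\in S)$ for all measurable $S$ and all datasets $\mathbf X,\mathbf Y$ that differ in at most one entry. It is $\rho$-zCDP if $D_\alpha(M(\mathbf X)\,\|\,M(\mathbf Y))\le\rho\alpha$ for all such $\mathbf X,\mathbf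 Y$ and all $\alpha\in(1,\infty)$, where $D_\alpha(\mathbb P\|\mathbb Q)=\frac1{\alpha-1}\ln\int\big(\frac{d\mathbb P}{d\mathbb Q}\big)^{\alpha-1}d\mathbb P$ is the Rényi divergence ($+\infty$ if $\mathbb P\not\ll\mathbb Q$). Then: 1. (Non-private risk.) For every $n\ge1$, $\mathfrak M_n\ge \dfrac{e^{-1}}{8n^2}$. The quadratic risk of the sample maximum satisfies $\int(\max_i X_i-\theta)^2\,dP_\theta\le C\theta^2/n^2$ for all $n\ge1$ and $\theta\in\Theta$, with an absolute constant $C$; and $\mathfrak M_n\le\sup_{\theta\in\Theta}\int(\max_i X_i-\theta)^2\,dP_\theta$. Consequently both $\mathfrak M_n$ and the worst-case risk of the sample maximum are $\Theta(1/n^2)$ as $n\to\infty$, so the sample maximum attains the minimax rate. 2. ($\epsilon$-DP.) If $n\epsilon>1$, then $\mathfrak M_n(\epsilon\text{-DP})\ge\dfrac{e^{-1}}{8(n\epsilon)^2}$. 3. ($\rho$-zCDP.) If $n\sqrt\rho>1$, then $\mathfrak M_n(\rho\text{-zCDP})\ge\dfrac{1-1/\sqrt2}{8n^2\rho}$. 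-/

import Mathlib

open MeasureTheory ProbabilityTheory Filter Asymptotics
open scoped ENNReal

noncomputable section

namespace UniformMinimax

/-- The minimax risk `inf_θhat sup_θ ∫ Φ (d (θhat X) θ) dP_θ(X)` of a statistical model `P` on
datasets of size `n`. The infimum is over all measurable estimators with values in the parameter
space, and the integrals are taken in `[0, ∞]`. -/
def minimaxRisk {𝒳 Θ : Type*} [MeasurableSpace 𝒳] [MeasurableSpace Θ] {n : ℕ}
    (P : Θ → Measure (Fin n → 𝒳)) (d : Θ → Θ → ℝ) (Φ : ℝ → ℝ) : ℝ≥0∞ :=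
  ⨅ (θhat : (Fin n → 𝒳) → Θ) (_ : Measurable θhat),
    ⨆ θ : Θ, ∫⁻ X, ENNReal.ofReal (Φ (d (θhat X) θ)) ∂(P θ)

/-- The private minimax risk: the infimum is over all randomized mechanisms (Markov kernels from
datasets to the parameter space) that satisfy the privacy condition `C`. -/
def privateMinimaxRisk {𝒳 Θ : Type*} [MeasurableSpace 𝒳] [MeasurableSpace Θ] {n : ℕ}
    (C : Kernel (Fin n → 𝒳) Θ → Prop)
    (P : Θ → Measure (Fin n → 𝒳)) (d : Θ → Θ → ℝ) (Φ : ℝ → ℝ) : ℝ≥0∞ :=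
  ⨅ (M : Kernel (Fin n → 𝒳) Θ) (_ : IsMarkovKernel M) (_ : C M),
    ⨆ θ : Θ, ∫⁻ X, ∫⁻ y, ENNReal.ofReal (Φ (d y θ)) ∂(M X) ∂(P θ)

open scoped Classical in
/-- `(ε, δ)`-differential privacy of a randomized mechanism. -/
def IsDP {𝒳 Y : Type*} [MeasurableSpace 𝒳] [MeasurableSpace Y] {n : ℕ} (ε δ : ℝ)
    (M : Kernel (Fin n → 𝒳) Y) : Prop :=
  ∀ X X' : Fin n → 𝒳, hammingDist X X' ≤ 1 → ∀ S : Set Y, MeasurableSet S →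
    M X S ≤ ENNReal.ofReal (Real.exp ε) * M X' S + ENNReal.ofReal δ

open scoped Classical in
/-- The Rényi divergence of level `α > 1` between probability measures,
`(α - 1)⁻¹ * log ∫ (dμ/dν) ^ (α - 1) dμ`, and `⊤` when `μ` is not absolutely continuous with
respect to `ν`. -/
def renyiDiv {Y : Type*} [MeasurableSpace Y] (α : ℝ) (μ ν : Measure Y) : EReal :=
  if μ ≪ ν then
    (((α - 1)⁻¹ : ℝ) : EReal) * ENNReal.log (∫⁻ y, (μ.rnDeriv ν y) ^ (α - 1) ∂μ)
  else ⊤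

open scoped Classical in
/-- `ρ`-zero concentrated differential privacy of a randomized mechanism. -/
def IsZCDP {𝒳 Y : Type*} [MeasurableSpace 𝒳] [MeasurableSpace Y] {n : ℕ} (ρ : ℝ)
    (M : Kernel (Fin n → 𝒳) Y) : Prop :=
  ∀ X X' : Fin n → 𝒳, hammingDist X X' ≤ 1 → ∀ α : ℝ, 1 < α →
    renyiDiv α (M X) (M X') ≤ ((ρ * α : ℝ) : EReal)

/-- The parameter space `(0, 1]`. -/
abbrev Param : Type := Set.Ioc (0 : ℝ) 1

/-- The feature space `[0, 1]`. -/
abbrev Feature : Type := Set.Icc (0 : ℝ) 1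

/-- The uniform distribution on `[0, θ]`: Lebesgue measure on `[0, 1]` conditioned on
the event `x ≤ θ`. -/
def uniformLaw (θ : Param) : Measure Feature :=
  ProbabilityTheory.cond volume {x : Feature | (x : ℝ) ≤ (θ : ℝ)}

/-- The law of `n` independent samples from the uniform distribution on `[0, θ]`. -/
def uniformModel (n : ℕ) (θ : Param) : Measure (Fin n → Feature) :=
  Measure.pi fun _ => uniformLaw θ

/-- The loss distance `|· - ·|` on the parameter space. -/
def absDist (θ θ' : Param) : ℝ := |(θ : ℝ) - (θ' : ℝ)|

/-- The sample maximum (meant for `n ≥ 1`). -/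
def sampleMax {n : ℕ} (X : Fin n → Feature) : ℝ := ⨆ i, ((X i : Feature) : ℝ)

/-- The quadratic risk of the sample maximum at the parameter `θ`. -/
def sampleMaxRisk (n : ℕ) (θ : Param) : ℝ≥0∞ :=
  ∫⁻ X, ENNReal.ofReal ((sampleMax X - (θ : ℝ)) ^ 2) ∂(uniformModel n θ)

end UniformMinimax

end

/-!
All lower bounds compare the parameters `1` and `1 - a`: the two squared losses of any output add up
to at least `a ^ 2 / 2`, so the worst-case risk is bounded below by the extent to which a mechanism
must behave alike under the two models.

Without privacy, the law of the sample under `1` dominates `(1 - a) ^ n` times its law under `1 - a`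
(`ofReal_smul_uniformModel_le`); this gives `ofReal_le_iSup_mechanismRisk_of_lt_one`, which is
applied with `a` of order `1 / n`. Estimators are covered as deterministic mechanisms.

With privacy, the two samples are coupled: draw each entry uniformly on `[0, 1]`, and redraw it
uniformly on `[0, 1 - a]` if it exceeds `1 - a`. The samples differ in `n * a` entries on average
(`lintegral_resampleCount`), and the privacy condition, applied one changed entry at a time
(`hammingDist_induction`), controls the change of the output law.

* Under `ε`-differential privacy the output laws compare up to `exp (-ε * k)`, where `k` is the
  number of redrawn entries. For `a = 1 / (n * ε)` this factor has mean at least `exp (-1)`, by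
  convexity of `exp` (`exp_neg_one_le_lintegral_resampleCount`).
* Under `ρ`-zCDP with `ρ ≤ 1 / 2`, the Rényi divergence of order two alone bounds the chi-square
  divergence of one step by `exp (2 * ρ) - 1 ≤ 4 * ρ`, hence the total variation distance by `√ρ`
  (`lintegral_le_add_of_lintegral_rnDeriv_le`). Total variation adds up along the coupling, to
  `2 / 3` on average for `a = 2 / (3 * n * √ρ)`, and the risk is at least
  `1 / (27 * n ^ 2 * ρ)`. For `ρ > 1 / 2` the claimed bound already holds without privacy.

The upper bound is the exponential tail `exp (-n * t / θ)` of `θ - max X`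
(`uniformModel_le_sub_sampleMax`), integrated against `2 * t`.
-/

open MeasureTheory ProbabilityTheory Filter Asymptotics
open scoped ENNReal

noncomputable section

namespace UniformMinimax

/-! ### The uniform model -/

lemma volume_le_param (θ : Param) :
    (volume : Measure Feature) {x | (x : ℝ) ≤ (θ : ℝ)} = ENNReal.ofReal θ :=
  unitInterval.volume_Iic (x := ⟨θ, θ.2.1.le, θ.2.2⟩)

lemma measurableSet_le_const (c : ℝ) : MeasurableSet {x : Feature | (x : ℝ) ≤ c} :=
  measurableSet_le measurable_subtype_coe measurable_const

lemma ofReal_param_ne_zero (θ : Param) : ENNReal.ofReal (θ : ℝ) ≠ 0 := by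
  simpa using θ.2.1

instance (θ : Param) : IsProbabilityMeasure (uniformLaw θ) :=
  cond_isProbabilityMeasure (by rw [volume_le_param]; exact ofReal_param_ne_zero θ)

instance (n : ℕ) (θ : Param) : IsProbabilityMeasure (uniformModel n θ) := by
  unfold uniformModel; infer_instance

lemma ofReal_smul_uniformLaw (θ : Param) :
    ENNReal.ofReal θ • uniformLaw θ
      = (volume : Measure Feature).restrict {x | (x : ℝ) ≤ (θ : ℝ)} := by
  rw [uniformLaw, ProbabilityTheory.cond, volume_le_param, smul_smul,
    ENNReal.mul_inv_cancel (ofReal_param_ne_zero θ) ENNReal.ofReal_ne_top, one_smul]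

/-- The right endpoint of the parameter space. -/
def oneParam : Param := ⟨1, one_pos, le_rfl⟩

lemma coe_oneParam : (oneParam : ℝ) = 1 := rfl

lemma uniformLaw_oneParam : uniformLaw oneParam = volume := by
  have h := ofReal_smul_uniformLaw oneParam
  have hs : {x : Feature | (x : ℝ) ≤ (oneParam : ℝ)} = Set.univ :=
    Set.eq_univ_of_forall fun x => x.2.2
  rwa [hs, Measure.restrict_univ, coe_oneParam, ENNReal.ofReal_one, one_smul] at h

/-- The law of the sample under `1`, restricted to samples below `θ`, is `θ ^ n` times the law of
the sample under `θ`. -/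
lemma ofReal_smul_uniformModel_le (n : ℕ) (θ : Param) :
    ENNReal.ofReal ((θ : ℝ) ^ n) • uniformModel n θ ≤ uniformModel n oneParam := by
  have h : ENNReal.ofReal ((θ : ℝ) ^ n) • uniformModel n θ
      = (uniformModel n oneParam).restrict
          (Set.univ.pi fun _ => {x : Feature | (x : ℝ) ≤ (θ : ℝ)}) := by
    unfold uniformModel
    rw [Measure.restrict_pi_pi, uniformLaw_oneParam, ← ofReal_smul_uniformLaw]
    have : SigmaFinite (ENNReal.ofReal (θ : ℝ) • uniformLaw θ) := by
      rw [ofReal_smul_uniformLaw]; infer_instance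
    refine (Measure.pi_eq fun s _ => ?_).symm
    simp only [Measure.smul_apply, smul_eq_mul, Measure.pi_pi, Finset.prod_mul_distrib,
      Finset.prod_const, Finset.card_univ, Fintype.card_fin, ENNReal.ofReal_pow θ.2.1.le]
  rw [h]
  exact Measure.restrict_le_self

lemma uniformLaw_le_sub_le_exp (θ : Param) {t : ℝ} (ht : 0 < t) :
    uniformLaw θ {x | (x : ℝ) ≤ θ - t} ≤ ENNReal.ofReal (Real.exp (-(t / θ))) := by
  rcases le_or_gt (θ : ℝ) t with h | h
  · -- the event is contained in the null set `{0}`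
    have hs : {x : Feature | (x : ℝ) ≤ θ - t} ⊆ {0} := fun x hx =>
      Subtype.ext (le_antisymm (le_trans hx (sub_nonpos.2 h)) x.2.1)
    have h0 : uniformLaw θ {x : Feature | (x : ℝ) ≤ θ - t} = 0 :=
      measure_mono_null hs (cond_absolutelyContinuous (measure_singleton _))
    rw [h0]; exact zero_le
  · have hθ : 0 < (θ : ℝ) := θ.2.1
    have h1 : (volume : Measure Feature) {x | (x : ℝ) ≤ θ - t} = ENNReal.ofReal (θ - t) :=
      volume_le_param ⟨θ - t, by linarith, by linarith [θ.2.2]⟩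
    rw [uniformLaw, cond_apply (measurableSet_le_const _), volume_le_param]
    calc (ENNReal.ofReal (θ : ℝ))⁻¹
          * volume ({x : Feature | (x : ℝ) ≤ θ} ∩ {x : Feature | (x : ℝ) ≤ θ - t})
        ≤ (ENNReal.ofReal (θ : ℝ))⁻¹ * ENNReal.ofReal (θ - t) := by
          rw [← h1]; gcongr 1; exact measure_mono Set.inter_subset_right
      _ = ENNReal.ofReal (1 - t / θ) := by
          rw [← ENNReal.ofReal_inv_of_pos hθ, ← ENNReal.ofReal_mul (inv_nonneg.2 hθ.le)]
          congr 1; field_simp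
      _ ≤ _ := ENNReal.ofReal_le_ofReal (by linarith [Real.add_one_le_exp (-(t / θ))])

lemma ae_coe_le_uniformLaw (θ : Param) : ∀ᵐ x : Feature ∂uniformLaw θ, (x : ℝ) ≤ θ :=
  ae_cond_mem (measurableSet_le_const _)

/-! ### Risk of the sample maximum -/

lemma measurable_sampleMax (n : ℕ) : Measurable (sampleMax (n := n)) :=
  Measurable.iSup fun i => measurable_subtype_coe.comp (measurable_pi_apply i)

lemma le_sampleMax {n : ℕ} (X : Fin n → Feature) (i : Fin n) : (X i : ℝ) ≤ sampleMax X :=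
  le_ciSup (f := fun i => (X i : ℝ)) (Set.finite_range _).bddAbove i

lemma ae_uniformModel_of_ae {n : ℕ} {θ : Param} (i : Fin n) {p : Feature → Prop}
    (h : ∀ᵐ x ∂uniformLaw θ, p x) : ∀ᵐ X ∂uniformModel n θ, p (X i) :=
  (measurePreserving_eval (fun _ : Fin n => uniformLaw θ) i).quasiMeasurePreserving.ae h

lemma ae_sampleMax_le {n : ℕ} (hn : 1 ≤ n) (θ : Param) :
    ∀ᵐ X ∂uniformModel n θ, sampleMax X ≤ θ := by
  have : Nonempty (Fin n) := ⟨⟨0, hn⟩⟩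
  have h := ae_all_iff.2 fun i : Fin n => ae_uniformModel_of_ae i (ae_coe_le_uniformLaw θ)
  exact h.mono fun X hX => ciSup_le hX

lemma ae_sampleMax_pos {n : ℕ} (hn : 1 ≤ n) (θ : Param) :
    ∀ᵐ X ∂uniformModel n θ, 0 < sampleMax X := by
  have h : ∀ᵐ x ∂uniformLaw θ, x ≠ (0 : Feature) := by
    have h0 : uniformLaw θ {0} = 0 := cond_absolutelyContinuous (measure_singleton _)
    simpa [ae_iff] using h0
  filter_upwards [ae_uniformModel_of_ae ⟨0, hn⟩ h] with X hX
  exact lt_of_lt_of_le (lt_of_le_of_ne (X _).2.1 fun h0 => hX (Subtype.ext h0.symm))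
    (le_sampleMax X _)

/-- The law of `θ - max X` has an exponential tail at scale `θ / n`. -/
lemma uniformModel_le_sub_sampleMax (n : ℕ) (θ : Param) {t : ℝ} (ht : 0 < t) :
    uniformModel n θ {X | t ≤ θ - sampleMax X} ≤ ENNReal.ofReal (Real.exp (-(n / θ * t))) := by
  have hs : {X : Fin n → Feature | t ≤ θ - sampleMax X}
      ⊆ Set.univ.pi fun _ => {x : Feature | (x : ℝ) ≤ θ - t} := fun X hX i _ => by
    have h1 := le_sampleMax X i
    have h2 : t ≤ θ - sampleMax X := hX
    change (X i : ℝ) ≤ θ - t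
    linarith
  calc uniformModel n θ {X | t ≤ θ - sampleMax X}
      ≤ (uniformLaw θ {x | (x : ℝ) ≤ θ - t}) ^ n := by
        refine (measure_mono hs).trans_eq ?_
        rw [uniformModel, Measure.pi_pi]; simp
    _ ≤ (ENNReal.ofReal (Real.exp (-(t / θ)))) ^ n := by
        gcongr; exact uniformLaw_le_sub_le_exp θ ht
    _ = _ := by
        rw [← ENNReal.ofReal_pow (Real.exp_pos _).le, ← Real.exp_nat_mul]
        congr 2; ring

lemma sampleMaxRisk_le {n : ℕ} (hn : 1 ≤ n) (θ : Param) :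
    sampleMaxRisk n θ ≤ ENNReal.ofReal (2 * (θ : ℝ) ^ 2 / (n : ℝ) ^ 2) := by
  have hθ : 0 < (θ : ℝ) := θ.2.1
  have hn0 : (0 : ℝ) < n := by exact_mod_cast hn
  have hb : 0 < (n : ℝ) / θ := div_pos hn0 hθ
  have hlay := lintegral_rpow_eq_lintegral_meas_le_mul (uniformModel n θ)
    (f := fun X => (θ : ℝ) - sampleMax X)
    ((ae_sampleMax_le hn θ).mono fun X hX => sub_nonneg.2 hX)
    (measurable_const.sub (measurable_sampleMax n)).aemeasurable (p := 2) two_pos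
  have hrisk : sampleMaxRisk n θ
      = ∫⁻ X, ENNReal.ofReal (((θ : ℝ) - sampleMax X) ^ (2 : ℝ)) ∂uniformModel n θ := by
    refine lintegral_congr fun X => ?_
    rw [Real.rpow_two, sub_sq_comm]
  have hint := Real.integral_rpow_mul_exp_neg_mul_Ioi (a := 2) two_pos hb
  have hval : ∫ t in Set.Ioi (0 : ℝ), t ^ ((2 : ℝ) - 1) * Real.exp (-((n : ℝ) / θ * t))
      = (θ : ℝ) ^ 2 / (n : ℝ) ^ 2 := by
    rw [hint, Real.Gamma_two, Real.rpow_two]; field_simp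
  -- a function with nonzero Bochner integral is integrable
  have hintg : IntegrableOn (fun t : ℝ => t ^ ((2 : ℝ) - 1) * Real.exp (-((n : ℝ) / θ * t)))
      (Set.Ioi 0) := by
    by_contra hcon
    rw [integral_undef hcon] at hval
    have : 0 < (θ : ℝ) ^ 2 / (n : ℝ) ^ 2 := by positivity
    linarith
  rw [hrisk, hlay]
  calc ENNReal.ofReal 2 * ∫⁻ t in Set.Ioi (0 : ℝ),
        uniformModel n θ {X | t ≤ θ - sampleMax X} * ENNReal.ofReal (t ^ ((2 : ℝ) - 1))
      ≤ ENNReal.ofReal 2 * ∫⁻ t in Set.Ioi (0 : ℝ),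
          ENNReal.ofReal (t ^ ((2 : ℝ) - 1) * Real.exp (-((n : ℝ) / θ * t))) := by
        gcongr 1
        refine setLIntegral_mono' measurableSet_Ioi fun t ht => ?_
        rw [mul_comm, ENNReal.ofReal_mul (Real.rpow_nonneg (le_of_lt ht) _)]
        gcongr
        exact uniformModel_le_sub_sampleMax n θ ht
    _ = ENNReal.ofReal 2 * ENNReal.ofReal ((θ : ℝ) ^ 2 / (n : ℝ) ^ 2) := by
        rw [← ofReal_integral_eq_lintegral_ofReal hintg, hval]
        filter_upwards [ae_restrict_mem measurableSet_Ioi] with t ht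
        have : (0 : ℝ) < t := ht
        positivity
    _ = _ := by rw [← ENNReal.ofReal_mul two_pos.le, mul_div_assoc]

lemma minimaxRisk_le_iSup_sampleMaxRisk {n : ℕ} (hn : 1 ≤ n) :
    minimaxRisk (uniformModel n) absDist (fun t => t ^ 2) ≤ ⨆ θ : Param, sampleMaxRisk n θ := by
  have : Nonempty (Fin n) := ⟨⟨0, hn⟩⟩
  have h1 (X : Fin n → Feature) : sampleMax X ≤ 1 := ciSup_le fun i => (X i).2.2
  -- The sample maximum may vanish, on a null event; there the estimator takes the value `1`.
  let f : (Fin n → Feature) → ℝ := fun X => if 0 < sampleMax X then sampleMax X else 1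
  have hf : Measurable f :=
    Measurable.ite (measurableSet_lt measurable_const (measurable_sampleMax n))
      (measurable_sampleMax n) measurable_const
  have hmem (X : Fin n → Feature) : f X ∈ Set.Ioc (0 : ℝ) 1 := by
    by_cases h : 0 < sampleMax X
    · simpa [f, h] using h1 X
    · simp [f, h]
  refine iInf₂_le_of_le (fun X => ⟨f X, hmem X⟩) (hf.subtype_mk) (iSup_mono fun θ => ?_)
  refine (lintegral_congr_ae ?_).le
  filter_upwards [ae_sampleMax_pos hn θ] with X hX
  simp [absDist, f, hX]

/-! ### Two-point bound for mechanisms without privacy constraint -/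

/-- The quadratic risk of a randomized mechanism at the parameter `θ`. -/
def mechanismRisk {n : ℕ} (M : Kernel (Fin n → Feature) Param) (θ : Param) : ℝ≥0∞ :=
  ∫⁻ X, ∫⁻ y, ENNReal.ofReal (absDist y θ ^ 2) ∂(M X) ∂(uniformModel n θ)

lemma measurable_loss (θ : Param) :
    Measurable fun y : Param => ENNReal.ofReal (absDist y θ ^ 2) := by
  unfold absDist; fun_prop

lemma measurable_lintegral_loss {n : ℕ} (M : Kernel (Fin n → Feature) Param) (θ : Param) :
    Measurable fun X => ∫⁻ y, ENNReal.ofReal (absDist y θ ^ 2) ∂(M X) :=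
  (measurable_loss θ).lintegral_kernel

/-- The parameter `1 - a`. -/
def subParam (a : ℝ) (h0 : 0 < a) (h1 : a < 1) : Param := ⟨1 - a, by linarith, by linarith⟩

lemma ofReal_le_loss_add_loss {a : ℝ} (h0 : 0 < a) (h1 : a < 1) (y : Param) :
    ENNReal.ofReal (a ^ 2 / 2) ≤ ENNReal.ofReal (absDist y oneParam ^ 2)
      + ENNReal.ofReal (absDist y (subParam a h0 h1) ^ 2) := by
  rw [← ENNReal.ofReal_add (sq_nonneg _) (sq_nonneg _)]
  refine ENNReal.ofReal_le_ofReal ?_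
  simp only [absDist, sq_abs, oneParam, subParam]
  nlinarith [sq_nonneg (2 * (y : ℝ) - 2 + a)]

lemma ofReal_le_lintegral_loss_add {a : ℝ} (h0 : 0 < a) (h1 : a < 1)
    (μ : Measure Param) [IsProbabilityMeasure μ] :
    ENNReal.ofReal (a ^ 2 / 2) ≤ ∫⁻ y, ENNReal.ofReal (absDist y oneParam ^ 2) ∂μ
      + ∫⁻ y, ENNReal.ofReal (absDist y (subParam a h0 h1) ^ 2) ∂μ := by
  rw [← lintegral_add_left (measurable_loss _)]
  calc ENNReal.ofReal (a ^ 2 / 2) = ∫⁻ _, ENNReal.ofReal (a ^ 2 / 2) ∂μ := by simp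
    _ ≤ _ := lintegral_mono fun y => ofReal_le_loss_add_loss h0 h1 y

lemma ofReal_le_iSup_mechanismRisk_of_lt_one {n : ℕ} (M : Kernel (Fin n → Feature) Param)
    [IsMarkovKernel M] {a : ℝ} (h0 : 0 < a) (h1 : a < 1) :
    ENNReal.ofReal (a ^ 2 * (1 - a) ^ n / (2 * (1 + (1 - a) ^ n)))
      ≤ ⨆ θ, mechanismRisk M θ := by
  set θ₁ := subParam a h0 h1
  set S := ⨆ θ, mechanismRisk M θ
  have ht : 0 < (1 - a) ^ n := pow_pos (by linarith) n
  set t := (1 - a) ^ n with ht_def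
  have hR0 : ENNReal.ofReal t * ∫⁻ X, ∫⁻ y, ENNReal.ofReal (absDist y oneParam ^ 2) ∂(M X)
      ∂(uniformModel n θ₁) ≤ S := by
    rw [← smul_eq_mul, ← lintegral_smul_measure]
    refine le_trans (lintegral_mono' (ofReal_smul_uniformModel_le n θ₁) le_rfl) ?_
    exact le_iSup (mechanismRisk M) oneParam
  have hR1 : mechanismRisk M θ₁ ≤ S := le_iSup (mechanismRisk M) θ₁
  have hsum : ENNReal.ofReal (a ^ 2 / 2)
      ≤ ∫⁻ X, ∫⁻ y, ENNReal.ofReal (absDist y oneParam ^ 2) ∂(M X) ∂(uniformModel n θ₁)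
        + mechanismRisk M θ₁ := by
    rw [mechanismRisk, ← lintegral_add_left (measurable_lintegral_loss M _)]
    calc ENNReal.ofReal (a ^ 2 / 2)
        = ∫⁻ _, ENNReal.ofReal (a ^ 2 / 2) ∂(uniformModel n θ₁) := by simp
      _ ≤ _ := lintegral_mono fun X => ofReal_le_lintegral_loss_add h0 h1 (M X)
  have key : ENNReal.ofReal t * ENNReal.ofReal (a ^ 2 / 2) ≤ S * ENNReal.ofReal (1 + t) := by
    calc ENNReal.ofReal t * ENNReal.ofReal (a ^ 2 / 2)
        ≤ ENNReal.ofReal t * (_ + mechanismRisk M θ₁) := by gcongr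
      _ ≤ S + ENNReal.ofReal t * S := by rw [mul_add]; gcongr
      _ = S * ENNReal.ofReal (1 + t) := by
          rw [ENNReal.ofReal_add one_pos.le ht.le, ENNReal.ofReal_one]; ring
  have hval : ENNReal.ofReal (a ^ 2 * t / (2 * (1 + t)))
      = ENNReal.ofReal t * ENNReal.ofReal (a ^ 2 / 2) / ENNReal.ofReal (1 + t) := by
    rw [← ENNReal.ofReal_mul ht.le, ← ENNReal.ofReal_div_of_pos (by linarith)]
    congr 1; field_simp
  rw [hval]
  exact ENNReal.div_le_of_le_mul key

lemma quarter_le_one_sub_inv_pow {n : ℕ} (hn : 2 ≤ n) : (1 / 4 : ℝ) ≤ (1 - 1 / n) ^ n := by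
  have hn' : (2 : ℝ) ≤ n := by exact_mod_cast hn
  have hinv : 1 / (n : ℝ) ≤ 1 / 2 := one_div_le_one_div_of_le two_pos hn'
  have hB := one_add_mul_self_le_rpow_one_add (s := -(1 / (n : ℝ))) (by linarith)
    (p := (n : ℝ) / 2) (by linarith)
  have h1 : 1 + (n : ℝ) / 2 * -(1 / (n : ℝ)) = 1 / 2 := by field_simp; norm_num
  rw [h1] at hB
  have hbase : 0 ≤ 1 + -(1 / (n : ℝ)) := by linarith
  have h2 : ((1 + -(1 / (n : ℝ))) ^ ((n : ℝ) / 2)) ^ 2 = (1 - 1 / n) ^ n := by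
    rw [← Real.rpow_natCast _ 2, ← Real.rpow_mul hbase, ← Real.rpow_natCast _ n]
    congr 1; push_cast; ring
  rw [← h2]
  nlinarith

lemma ofReal_le_iSup_mechanismRisk_of_two_le {n : ℕ} (hn : 2 ≤ n)
    (M : Kernel (Fin n → Feature) Param) [IsMarkovKernel M] :
    ENNReal.ofReal (1 / (10 * (n : ℝ) ^ 2)) ≤ ⨆ θ, mechanismRisk M θ := by
  have hn' : (2 : ℝ) ≤ n := by exact_mod_cast hn
  have hlt : 1 / (n : ℝ) < 1 := by rw [div_lt_one] <;> linarith
  refine le_trans (ENNReal.ofReal_le_ofReal ?_)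
    (ofReal_le_iSup_mechanismRisk_of_lt_one M (a := 1 / (n : ℝ)) (by positivity) hlt)
  have ht := quarter_le_one_sub_inv_pow hn
  set t := (1 - 1 / (n : ℝ)) ^ n
  have h1 : (1 / (n : ℝ)) ^ 2 * t / (2 * (1 + t)) = (1 / (n : ℝ) ^ 2) * (t / (2 * (1 + t))) := by
    field_simp
  have h2 : (1 : ℝ) / 10 ≤ t / (2 * (1 + t)) := by
    rw [div_le_div_iff₀ (by norm_num) (by linarith)]; linarith
  have h3 : 1 / (10 * (n : ℝ) ^ 2) = (1 / (n : ℝ) ^ 2) * (1 / 10) := by field_simp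
  rw [h1, h3]
  gcongr

lemma ofReal_le_iSup_mechanismRisk_one (M : Kernel (Fin 1 → Feature) Param) [IsMarkovKernel M] :
    ENNReal.ofReal (9 / 175) ≤ ⨆ θ, mechanismRisk M θ := by
  -- `a = 3 / 5` is close to the maximizer of `a ^ 2 * (1 - a) / (2 * (2 - a))`
  convert ofReal_le_iSup_mechanismRisk_of_lt_one M (a := 3 / 5) (by norm_num) (by norm_num)
    using 2
  norm_num

lemma exp_neg_one_le : Real.exp (-1) ≤ 2 / 5 := by
  rw [Real.exp_neg, inv_le_comm₀ (Real.exp_pos 1) (by norm_num)]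
  linarith [Real.exp_one_gt_d9]

lemma exp_div_le_iSup_mechanismRisk {n : ℕ} (hn : 1 ≤ n)
    (M : Kernel (Fin n → Feature) Param) [IsMarkovKernel M] :
    ENNReal.ofReal (Real.exp (-1) / (8 * (n : ℝ) ^ 2)) ≤ ⨆ θ, mechanismRisk M θ := by
  have he := exp_neg_one_le
  rcases hn.eq_or_lt with rfl | hn
  · refine le_trans (ENNReal.ofReal_le_ofReal ?_) (ofReal_le_iSup_mechanismRisk_one M)
    norm_num; linarith
  · refine le_trans (ENNReal.ofReal_le_ofReal ?_) (ofReal_le_iSup_mechanismRisk_of_two_le hn M)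
    have hn0 : (0 : ℝ) < n := by exact_mod_cast (by omega : 0 < n)
    rw [div_le_div_iff₀ (by positivity) (by positivity)]
    nlinarith [sq_nonneg (n : ℝ)]

/-- An estimator is the deterministic mechanism it defines, with the same risk. -/
lemma exp_div_le_minimaxRisk {n : ℕ} (hn : 1 ≤ n) :
    ENNReal.ofReal (Real.exp (-1) / (8 * (n : ℝ) ^ 2)) ≤
      minimaxRisk (uniformModel n) absDist (fun t => t ^ 2) := by
  refine le_iInf₂ fun θhat hm => ?_
  refine (exp_div_le_iSup_mechanismRisk hn (Kernel.deterministic θhat hm)).trans_eq ?_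
  refine iSup_congr fun θ => lintegral_congr fun X => ?_
  rw [Kernel.deterministic_apply, lintegral_dirac]

/-! ### Coupling of the models at `1` and at `θ` -/

/-- Source of randomness for the coupling in one coordinate: a draw from the uniform law at `1` and
an independent draw from the uniform law at `θ`. -/
def couplingLaw (θ : Param) : Measure (Feature × Feature) :=
  (uniformLaw oneParam).prod (uniformLaw θ)

instance (θ : Param) : IsProbabilityMeasure (couplingLaw θ) := by
  unfold couplingLaw; infer_instance

open scoped Classical in
/-- Keep the first draw if it is at most `θ`, and replace it by the second one otherwise. -/
def resample (θ : Param) (w : Feature × Feature) : Feature :=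
  if (w.1 : ℝ) ≤ θ then w.1 else w.2

lemma measurePreserving_resample (θ : Param) :
    MeasurePreserving (resample θ) (couplingLaw θ) (uniformLaw θ) := by
  classical
  set B : Set Feature := {x | (x : ℝ) ≤ θ} with hB
  have hBm : MeasurableSet B := measurableSet_le_const _
  have hm : Measurable (resample θ) :=
    Measurable.ite (measurable_fst hBm) measurable_fst measurable_snd
  refine ⟨hm, Measure.ext fun s hs => ?_⟩
  have hpre : resample θ ⁻¹' s = (B ∩ s) ×ˢ Set.univ ∪ Bᶜ ×ˢ s := by
    ext w
    by_cases h : (w.1 : ℝ) ≤ θ <;> simp [resample, hB, h]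
  have hdisj : Disjoint ((B ∩ s) ×ˢ (Set.univ : Set Feature)) (Bᶜ ×ˢ s) :=
    Set.disjoint_left.2 fun w h1 h2 => h2.1 h1.1.1
  have hBs : (volume : Measure Feature) (B ∩ s) = ENNReal.ofReal θ * uniformLaw θ s := by
    rw [Set.inter_comm, ← Measure.restrict_apply hs, ← ofReal_smul_uniformLaw, Measure.smul_apply,
      smul_eq_mul]
  rw [Measure.map_apply hm hs, hpre, measure_union hdisj (hBm.compl.prod hs), couplingLaw,
    Measure.prod_prod, Measure.prod_prod, measure_univ, mul_one, uniformLaw_oneParam, hBs,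
    ← add_mul, prob_compl_eq_one_sub hBm, hB, volume_le_param,
    add_tsub_cancel_of_le (by simpa using θ.2.2), one_mul]

/-- Law of the `n` independent pairs of draws behind the coupling of two samples. -/
def sampleCoupling (n : ℕ) (θ : Param) : Measure (Fin n → Feature × Feature) :=
  Measure.pi fun _ => couplingLaw θ

instance (n : ℕ) (θ : Param) : IsProbabilityMeasure (sampleCoupling n θ) := by
  unfold sampleCoupling; infer_instance

lemma measurePreserving_fst_sampleCoupling (n : ℕ) (θ : Param) :
    MeasurePreserving (fun w i => (w i).1) (sampleCoupling n θ) (uniformModel n oneParam) :=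
  measurePreserving_pi _ _ fun _ => measurePreserving_fst

lemma measurePreserving_resample_sampleCoupling (n : ℕ) (θ : Param) :
    MeasurePreserving (fun w i => resample θ (w i)) (sampleCoupling n θ) (uniformModel n θ) :=
  measurePreserving_pi _ _ fun _ => measurePreserving_resample θ

open scoped Classical in
/-- The number of resampled coordinates. -/
def resampleCount {n : ℕ} (θ : Param) (w : Fin n → Feature × Feature) : ℕ :=
  ∑ i, if ((w i).1 : ℝ) ≤ θ then 0 else 1

lemma measurable_resampleCount (n : ℕ) (θ : Param) :
    Measurable (resampleCount (n := n) θ) := by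
  refine Finset.measurable_sum _ fun i _ => Measurable.ite ?_ measurable_const measurable_const
  exact (measurable_fst.comp (measurable_pi_apply i)) (measurableSet_le_const _)

lemma hammingDist_resample_le {n : ℕ} [DecidableEq Feature] (θ : Param)
    (w : Fin n → Feature × Feature) :
    hammingDist (fun i => (w i).1) (fun i => resample θ (w i)) ≤ resampleCount θ w := by
  classical
  rw [hammingDist, Finset.card_filter, resampleCount]
  refine Finset.sum_le_sum fun i _ => ?_
  by_cases h : ((w i).1 : ℝ) ≤ θ
  · simp [resample, h]
  · simp only [h, if_false]; split_ifs <;> simp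

lemma lintegral_resampleCount (n : ℕ) (θ : Param) :
    ∫⁻ w, (resampleCount θ w : ℝ≥0∞) ∂(sampleCoupling n θ) = ENNReal.ofReal (n * (1 - θ)) := by
  classical
  have hB : MeasurableSet {x : Feature | (x : ℝ) ≤ θ}ᶜ := (measurableSet_le_const _).compl
  have h1 (w : Fin n → Feature × Feature) : (resampleCount θ w : ℝ≥0∞)
      = ∑ i, Set.indicator {x : Feature | (x : ℝ) ≤ θ}ᶜ (fun _ => (1 : ℝ≥0∞)) (w i).1 := by
    rw [resampleCount, Nat.cast_sum]
    refine Finset.sum_congr rfl fun i _ => ?_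
    by_cases h : ((w i).1 : ℝ) ≤ θ <;> simp [h]
  have hX (i : Fin n) : MeasurePreserving (fun w : Fin n → Feature × Feature => (w i).1)
      (sampleCoupling n θ) (uniformLaw oneParam) :=
    measurePreserving_fst.comp (measurePreserving_eval (fun _ : Fin n => couplingLaw θ) i)
  have hind : Measurable (Set.indicator {x : Feature | (x : ℝ) ≤ θ}ᶜ fun _ => (1 : ℝ≥0∞)) :=
    measurable_const.indicator hB
  have hm (i : Fin n) : Measurable fun w : Fin n → Feature × Feature =>
      Set.indicator {x : Feature | (x : ℝ) ≤ θ}ᶜ (fun _ => (1 : ℝ≥0∞)) (w i).1 :=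
    hind.comp (hX i).measurable
  simp_rw [h1]
  rw [lintegral_finsetSum _ fun i _ => hm i]
  simp_rw [fun i => (hX i).lintegral_comp hind]
  rw [lintegral_indicator_const hB, one_mul, uniformLaw_oneParam,
    prob_compl_eq_one_sub (measurableSet_le_const _), volume_le_param, Finset.sum_const,
    Finset.card_univ, Fintype.card_fin, nsmul_eq_mul, ENNReal.ofReal_mul (Nat.cast_nonneg n),
    ENNReal.ofReal_sub _ θ.2.1.le, ENNReal.ofReal_one, ENNReal.ofReal_natCast]

/-- A relation between datasets that holds on the diagonal and degrades by one level at each change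
of a single entry holds at the level of the Hamming distance. -/
lemma hammingDist_induction {ι 𝒳 : Type*} [Fintype ι] [DecidableEq 𝒳]
    {R : ℕ → (ι → 𝒳) → (ι → 𝒳) → Prop} (refl : ∀ X, R 0 X X)
    (step : ∀ k X Y Z, hammingDist X Y ≤ 1 → R k Y Z → R (k + 1) X Z) (X Z : ι → 𝒳) :
    R (hammingDist X Z) X Z := by
  classical
  induction hk : hammingDist X Z generalizing X with
  | zero => rw [hammingDist_eq_zero.1 hk]; exact refl Z
  | succ k ih =>
    obtain ⟨i, hi⟩ : ∃ i, X i ≠ Z i := by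
      by_contra! h
      rw [funext h, hammingDist_self] at hk
      omega
    have herase : ({j | Function.update X i (Z i) j ≠ Z j} : Finset ι)
        = ({j | X j ≠ Z j} : Finset ι).erase i := by
      ext j
      rcases eq_or_ne j i with rfl | hj <;> simp [*]
    refine step k X (Function.update X i (Z i)) Z ?_ (ih _ ?_)
    · refine Finset.card_le_one.2 fun j hj l hl => ?_
      have aux : ∀ j, X j ≠ Function.update X i (Z i) j → j = i := fun j h => by
        by_contra hne
        simp [hne] at h
      rw [aux j (by simpa using hj), aux l (by simpa using hl)]
    · rw [hammingDist, herase, Finset.card_erase_of_mem (by simpa using hi)]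
      have : Finset.card ({j | X j ≠ Z j} : Finset ι) = k + 1 := hk
      omega

/-! ### Differential privacy -/

lemma IsDP.lintegral_le {𝒳 Y : Type*} [MeasurableSpace 𝒳] [MeasurableSpace Y] [DecidableEq 𝒳]
    {n : ℕ} {ε : ℝ} {M : Kernel (Fin n → 𝒳) Y} (hM : IsDP ε 0 M) (f : Y → ℝ≥0∞)
    (X Z : Fin n → 𝒳) :
    ENNReal.ofReal (Real.exp (-(ε * hammingDist X Z))) * ∫⁻ y, f y ∂(M Z)
      ≤ ∫⁻ y, f y ∂(M X) := by
  refine hammingDist_induction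
    (R := fun k X Z => ENNReal.ofReal (Real.exp (-(ε * (k : ℕ)))) * ∫⁻ y, f y ∂(M Z)
      ≤ ∫⁻ y, f y ∂(M X)) (fun X => by simp) (fun k X Y Z hXY hYZ => ?_) X Z
  have hle : M Y ≤ ENNReal.ofReal (Real.exp ε) • M X := by
    refine Measure.le_iff.2 fun s hs => ?_
    have h := hM Y X (by convert (hammingDist_comm Y X).trans_le hXY) s hs
    simpa using h
  have hstep : ∫⁻ y, f y ∂(M Y) ≤ ENNReal.ofReal (Real.exp ε) * ∫⁻ y, f y ∂(M X) := by
    rw [← smul_eq_mul, ← lintegral_smul_measure]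
    exact lintegral_mono' hle le_rfl
  have hexp : Real.exp (-(ε * ((k + 1 : ℕ) : ℝ))) = Real.exp (-ε) * Real.exp (-(ε * k)) := by
    rw [← Real.exp_add]; congr 1; push_cast; ring
  rw [hexp, ENNReal.ofReal_mul (Real.exp_pos _).le, mul_assoc]
  calc _ ≤ ENNReal.ofReal (Real.exp (-ε))
        * (ENNReal.ofReal (Real.exp ε) * ∫⁻ y, f y ∂(M X)) := by
        gcongr 1; exact hYZ.trans hstep
    _ = ∫⁻ y, f y ∂(M X) := by
        rw [← mul_assoc, ← ENNReal.ofReal_mul (Real.exp_pos _).le, ← Real.exp_add]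
        simp

/-- Jensen's inequality for `exp`, obtained by integrating its tangent at `-1`. -/
lemma exp_neg_one_le_lintegral_resampleCount {n : ℕ} {θ : Param} {ε : ℝ} (hε : 0 ≤ ε)
    (h : ε * (n * (1 - θ)) = 1) :
    ENNReal.ofReal (Real.exp (-1))
      ≤ ∫⁻ w : Fin n → Feature × Feature,
          ENNReal.ofReal (Real.exp (-(ε * resampleCount θ w))) ∂(sampleCoupling n θ) := by
  set c := ENNReal.ofReal (Real.exp (-1)) with hc
  have hpt (w : Fin n → Feature × Feature) :
      c + c ≤ ENNReal.ofReal (Real.exp (-(ε * resampleCount θ w)))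
        + c * ENNReal.ofReal ε * (resampleCount θ w : ℝ≥0∞) := by
    rw [hc, ← ENNReal.ofReal_natCast, ← ENNReal.ofReal_mul (Real.exp_pos _).le,
      ← ENNReal.ofReal_mul (by positivity), ← ENNReal.ofReal_add (by positivity) (by positivity),
      ← ENNReal.ofReal_add (by positivity) (by positivity)]
    refine ENNReal.ofReal_le_ofReal ?_
    have h1 := Real.add_one_le_exp (1 - ε * resampleCount θ w)
    have h2 : Real.exp (-(ε * resampleCount θ w))
        = Real.exp (-1) * Real.exp (1 - ε * resampleCount θ w) := by
      rw [← Real.exp_add]; congr 1; ring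
    rw [h2]
    nlinarith [Real.exp_pos (-1)]
  have hmeas : Measurable fun w : Fin n → Feature × Feature => (resampleCount θ w : ℝ≥0∞) :=
    (measurable_of_countable _).comp (measurable_resampleCount n θ)
  have hint : c * ENNReal.ofReal ε * ENNReal.ofReal (n * (1 - θ)) = c := by
    rw [mul_assoc, ← ENNReal.ofReal_mul hε, h, ENNReal.ofReal_one, mul_one]
  refine (ENNReal.add_le_add_iff_right (a := c) ENNReal.ofReal_ne_top).1 ?_
  calc c + c = ∫⁻ _, (c + c) ∂(sampleCoupling n θ) := by simp
    _ ≤ _ := lintegral_mono hpt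
    _ = _ := by
      rw [lintegral_add_right _ (hmeas.const_mul _), lintegral_const_mul _ hmeas,
        lintegral_resampleCount, hint]

lemma mechanismRisk_add_eq {n : ℕ} (M : Kernel (Fin n → Feature) Param) (θ : Param) :
    mechanismRisk M oneParam + mechanismRisk M θ
      = ∫⁻ w, (∫⁻ y, ENNReal.ofReal (absDist y oneParam ^ 2) ∂(M fun i => (w i).1)
        + ∫⁻ y, ENNReal.ofReal (absDist y θ ^ 2) ∂(M fun i => resample θ (w i)))
          ∂(sampleCoupling n θ) := by
  have hX := measurePreserving_fst_sampleCoupling n θ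
  have hY := measurePreserving_resample_sampleCoupling n θ
  have hm : Measurable fun w : Fin n → Feature × Feature =>
      ∫⁻ y, ENNReal.ofReal (absDist y oneParam ^ 2) ∂(M fun i => (w i).1) :=
    (measurable_lintegral_loss M oneParam).comp hX.measurable
  rw [lintegral_add_left hm]
  exact congr_arg₂ _ (hX.lintegral_comp (measurable_lintegral_loss M oneParam)).symm
    (hY.lintegral_comp (measurable_lintegral_loss M θ)).symm

lemma le_iSup_mechanismRisk_of_le_add {n : ℕ} {M : Kernel (Fin n → Feature) Param}
    {c : ℝ} {θ θ' : Param} (h : ENNReal.ofReal c ≤ mechanismRisk M θ + mechanismRisk M θ') :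
    ENNReal.ofReal (c / 2) ≤ ⨆ θ, mechanismRisk M θ := by
  rw [ENNReal.ofReal_div_of_pos two_pos]
  refine ENNReal.div_le_of_le_mul (h.trans ?_)
  rw [ENNReal.ofReal_ofNat, mul_two]
  exact add_le_add (le_iSup (mechanismRisk M) θ) (le_iSup (mechanismRisk M) θ')

lemma IsDP.le_iSup_mechanismRisk {n : ℕ} {ε : ℝ} (hnε : 1 < n * ε)
    {M : Kernel (Fin n → Feature) Param} [IsMarkovKernel M] (hM : IsDP ε 0 M) :
    ENNReal.ofReal (Real.exp (-1) / (8 * (n * ε) ^ 2)) ≤ ⨆ θ, mechanismRisk M θ := by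
  classical
  have hε : 0 < ε := by
    by_contra! h
    have := mul_nonpos_of_nonneg_of_nonpos (Nat.cast_nonneg (α := ℝ) n) h
    linarith
  -- with this separation the expected number of resampled coordinates is `1 / ε`
  set a := 1 / (n * ε) with ha
  have h0 : 0 < a := by positivity
  have h1 : a < 1 := by rw [ha, div_lt_one] <;> linarith
  set θ₁ := subParam a h0 h1 with hθ₁
  have hmean : ε * (n * (1 - θ₁)) = 1 := by
    have : 1 - (θ₁ : ℝ) = a := by simp [hθ₁, subParam]
    have hpos : (n : ℝ) * ε ≠ 0 := by positivity
    rw [this, ha, ← mul_assoc, mul_comm ε]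
    exact mul_one_div_cancel hpos
  have hpt (w : Fin n → Feature × Feature) :
      ENNReal.ofReal (Real.exp (-(ε * resampleCount θ₁ w))) * ENNReal.ofReal (a ^ 2 / 2)
        ≤ ∫⁻ y, ENNReal.ofReal (absDist y oneParam ^ 2) ∂(M fun i => (w i).1)
          + ∫⁻ y, ENNReal.ofReal (absDist y θ₁ ^ 2) ∂(M fun i => resample θ₁ (w i)) := by
    have hd : (hammingDist (fun i => (w i).1) (fun i => resample θ₁ (w i)) : ℝ)
        ≤ resampleCount θ₁ w := by exact_mod_cast hammingDist_resample_le θ₁ w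
    have hdp := hM.lintegral_le (fun y => ENNReal.ofReal (absDist y oneParam ^ 2))
      (fun i => (w i).1) (fun i => resample θ₁ (w i))
    calc _ ≤ ENNReal.ofReal (Real.exp (-(ε * resampleCount θ₁ w)))
          * (∫⁻ y, ENNReal.ofReal (absDist y oneParam ^ 2) ∂(M fun i => resample θ₁ (w i))
          + ∫⁻ y, ENNReal.ofReal (absDist y θ₁ ^ 2) ∂(M fun i => resample θ₁ (w i))) := by
          gcongr; exact ofReal_le_lintegral_loss_add h0 h1 _
      _ ≤ _ := by
          rw [mul_add]
          refine add_le_add (le_trans ?_ hdp) ?_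
          · gcongr
          · refine mul_le_of_le_one_left' (ENNReal.ofReal_le_one.2 (Real.exp_le_one_iff.2 ?_))
            have : 0 ≤ ε * resampleCount θ₁ w := by positivity
            linarith
  have hsum : ENNReal.ofReal (Real.exp (-1) * (a ^ 2 / 2))
      ≤ mechanismRisk M oneParam + mechanismRisk M θ₁ := by
    rw [ENNReal.ofReal_mul (Real.exp_pos _).le, mechanismRisk_add_eq]
    refine le_trans ?_ (lintegral_mono hpt)
    rw [lintegral_mul_const' _ _ ENNReal.ofReal_ne_top]
    gcongr
    exact exp_neg_one_le_lintegral_resampleCount hε.le hmean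
  refine le_trans (ENNReal.ofReal_le_ofReal ?_) (le_iSup_mechanismRisk_of_le_add hsum)
  have he := Real.exp_pos (-1)
  have h2 : Real.exp (-1) * (a ^ 2 / 2) / 2 = Real.exp (-1) / (4 * (n * ε) ^ 2) := by
    rw [ha]; field_simp; norm_num
  rw [h2]
  gcongr; norm_num

/-! ### Zero concentrated differential privacy -/

lemma absolutelyContinuous_of_renyiDiv_le {Y : Type*} [MeasurableSpace Y] {μ ν : Measure Y}
    {α c : ℝ} (h : renyiDiv α μ ν ≤ (c : EReal)) : μ ≪ ν := by
  by_contra hac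
  rw [renyiDiv, if_neg hac] at h
  exact absurd (top_le_iff.1 h) (EReal.coe_ne_top c)

/-- At order two, the exponential of the Rényi divergence is `1` plus the chi-square divergence. -/
lemma lintegral_rnDeriv_le_of_renyiDiv_two_le {Y : Type*} [MeasurableSpace Y] {μ ν : Measure Y}
    {c : ℝ} (h : renyiDiv 2 μ ν ≤ (c : EReal)) :
    ∫⁻ y, μ.rnDeriv ν y ∂μ ≤ ENNReal.ofReal (Real.exp c) := by
  rw [renyiDiv, if_pos (absolutelyContinuous_of_renyiDiv_le h)] at h
  norm_num at h
  rw [← EReal.exp_coe, ← ENNReal.exp_log (∫⁻ y, μ.rnDeriv ν y ∂μ)]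
  exact EReal.exp_monotone h

/-- A chi-square divergence of at most `4 τ ^ 2` bounds the total variation distance by `τ`.
The proof integrates `f * p - f ≤ (p - 1) / 2 + (p - 1) ^ 2 / (8 * τ) + τ / 2`, where `p` is the
density of `μ` with respect to `ν`. -/
lemma lintegral_le_add_of_lintegral_rnDeriv_le {Y : Type*} [MeasurableSpace Y] {μ ν : Measure Y}
    [IsProbabilityMeasure μ] [IsProbabilityMeasure ν] (hac : μ ≪ ν) {τ : ℝ} (hτ : 0 < τ)
    (h : ∫⁻ y, μ.rnDeriv ν y ∂μ ≤ ENNReal.ofReal (1 + 4 * τ ^ 2))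
    {f : Y → ℝ≥0∞} (hf : Measurable f) (hf1 : ∀ y, f y ≤ 1) :
    ∫⁻ y, f y ∂μ ≤ ∫⁻ y, f y ∂ν + ENNReal.ofReal τ := by
  set p := μ.rnDeriv ν with hp
  have hpm : Measurable p := Measure.measurable_rnDeriv μ ν
  have hpp_meas : Measurable fun y => p y * p y := hpm.mul hpm
  have hpf : ∫⁻ y, p y * f y ∂ν = ∫⁻ y, f y ∂μ := lintegral_rnDeriv_mul hac hf.aemeasurable
  have hpp : ∫⁻ y, p y * p y ∂ν ≤ ENNReal.ofReal (1 + 4 * τ ^ 2) :=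
    (lintegral_rnDeriv_mul hac hpm.aemeasurable).trans_le h
  have hp1 : ∫⁻ y, p y ∂ν = 1 := by rw [Measure.lintegral_rnDeriv hac, measure_univ]
  have hpt : ∀ᵐ y ∂ν, p y * f y + ENNReal.ofReal (1 / 2) + ENNReal.ofReal (1 / (4 * τ)) * p y
      ≤ f y + ENNReal.ofReal (1 / 2) * p y + ENNReal.ofReal (1 / (8 * τ)) * (p y * p y)
        + ENNReal.ofReal (1 / (8 * τ) + τ / 2) := by
    filter_upwards [Measure.rnDeriv_lt_top μ ν] with y hy
    rw [← hp] at hy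
    generalize p y = P at hy
    have hF1 := hf1 y
    generalize f y = F at hF1
    lift P to NNReal using hy.ne
    lift F to NNReal using ne_top_of_le_ne_top ENNReal.one_ne_top hF1
    have hF1' : (F : ℝ) ≤ 1 := by exact_mod_cast hF1
    have hF0 : (0 : ℝ) ≤ F := F.2
    have hP0 : (0 : ℝ) ≤ P := P.2
    have hreal : (P : ℝ) * F + 1 / 2 + 1 / (4 * τ) * P
        ≤ F + 1 / 2 * P + 1 / (8 * τ) * (P * P) + (1 / (8 * τ) + τ / 2) := by
      have habs : ((F : ℝ) - 1 / 2) * (P - 1) ≤ |(P : ℝ) - 1| / 2 := by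
        have h1 : |(F : ℝ) - 1 / 2| ≤ 1 / 2 := abs_le.2 ⟨by linarith, by linarith⟩
        have h2 := le_abs_self (((F : ℝ) - 1 / 2) * (P - 1))
        rw [abs_mul] at h2
        nlinarith [abs_nonneg ((P : ℝ) - 1)]
      have hamgm : |(P : ℝ) - 1| / 2 ≤ ((P : ℝ) - 1) ^ 2 / (8 * τ) + τ / 2 := by
        have h3 : ((P : ℝ) - 1) ^ 2 / (8 * τ) + τ / 2 - |(P : ℝ) - 1| / 2
            = (|(P : ℝ) - 1| - 2 * τ) ^ 2 / (8 * τ) := by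
          rw [sub_sq |(P : ℝ) - 1|, sq_abs]; field_simp; ring
        have h4 : 0 ≤ (|(P : ℝ) - 1| - 2 * τ) ^ 2 / (8 * τ) := by positivity
        linarith
      have hexp : ((P : ℝ) - 1) ^ 2 / (8 * τ)
          = 1 / (8 * τ) * (P * P) - 1 / (4 * τ) * P + 1 / (8 * τ) := by
        field_simp; ring
      linarith
    have h5 := ENNReal.ofReal_le_ofReal hreal
    rwa [ENNReal.ofReal_add (by positivity) (by positivity),
      ENNReal.ofReal_add (by positivity) (by positivity),
      ENNReal.ofReal_add (by positivity) (by positivity),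
      ENNReal.ofReal_add (by positivity) (by positivity),
      ENNReal.ofReal_add (by positivity) (by positivity),
      ENNReal.ofReal_mul (by positivity), ENNReal.ofReal_mul (by positivity),
      ENNReal.ofReal_mul (by positivity), ENNReal.ofReal_mul (by positivity),
      ENNReal.ofReal_mul (by positivity), ENNReal.ofReal_coe_nnreal,
      ENNReal.ofReal_coe_nnreal] at h5
  have hint := lintegral_mono_ae hpt
  rw [lintegral_add_right _ (hpm.const_mul _), lintegral_add_right _ measurable_const,
    lintegral_add_right _ measurable_const,
    lintegral_add_right _ (hpp_meas.const_mul _), lintegral_add_right _ (hpm.const_mul _),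
    lintegral_const_mul _ hpm, lintegral_const_mul _ hpm, lintegral_const_mul _ hpp_meas,
    lintegral_const, lintegral_const, measure_univ, hpf, hp1] at hint
  simp only [mul_one] at hint
  have hfin : ENNReal.ofReal (1 / 2) + ENNReal.ofReal (1 / (4 * τ)) ≠ ⊤ := by finiteness
  refine (ENNReal.add_le_add_iff_right hfin).1 ?_
  calc _ = _ := (add_assoc _ _ _).symm
    _ ≤ _ := hint
    _ ≤ ∫⁻ y, f y ∂ν + ENNReal.ofReal (1 / 2)
        + ENNReal.ofReal (1 / (8 * τ)) * ENNReal.ofReal (1 + 4 * τ ^ 2)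
        + ENNReal.ofReal (1 / (8 * τ) + τ / 2) := by gcongr
    _ = ∫⁻ y, f y ∂ν + ENNReal.ofReal τ
        + (ENNReal.ofReal (1 / 2) + ENNReal.ofReal (1 / (4 * τ))) := by
      rw [← ENNReal.ofReal_mul (by positivity)]
      simp only [add_assoc]
      rw [← ENNReal.ofReal_add (by positivity) (by positivity),
        ← ENNReal.ofReal_add (by positivity) (by positivity),
        ← ENNReal.ofReal_add (by positivity) (by positivity),
        ← ENNReal.ofReal_add (by positivity) (by positivity)]
      congr 2
      field_simp; ring

lemma IsZCDP.lintegral_le_add {𝒳 Y : Type*} [MeasurableSpace 𝒳] [MeasurableSpace Y]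
    [DecidableEq 𝒳] {n : ℕ} {ρ : ℝ} (hρ0 : 0 < ρ) (hρ : ρ ≤ 1 / 2) {M : Kernel (Fin n → 𝒳) Y}
    [IsMarkovKernel M] (hM : IsZCDP ρ M) {f : Y → ℝ≥0∞} (hf : Measurable f) (hf1 : ∀ y, f y ≤ 1)
    (X Z : Fin n → 𝒳) :
    ∫⁻ y, f y ∂(M X) ≤ ∫⁻ y, f y ∂(M Z) + ENNReal.ofReal √ρ * hammingDist X Z := by
  refine hammingDist_induction
    (R := fun k X Z => ∫⁻ y, f y ∂(M X) ≤ ∫⁻ y, f y ∂(M Z) + ENNReal.ofReal √ρ * (k : ℕ))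
    (fun X => by simp) (fun k X Y Z hXY hYZ => ?_) X Z
  have hdiv := hM X Y (by convert hXY) 2 one_lt_two
  have hexp : Real.exp (ρ * 2) ≤ 1 + 4 * √ρ ^ 2 := by
    have h1 := Real.abs_exp_sub_one_sub_id_le (x := ρ * 2)
      (by rw [abs_of_nonneg (by positivity)]; linarith)
    have h2 := (abs_le.1 h1).2
    rw [Real.sq_sqrt hρ0.le]
    nlinarith
  have hstep : ∫⁻ y, f y ∂(M X) ≤ ∫⁻ y, f y ∂(M Y) + ENNReal.ofReal √ρ :=
    lintegral_le_add_of_lintegral_rnDeriv_le (absolutelyContinuous_of_renyiDiv_le hdiv)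
      (Real.sqrt_pos.2 hρ0)
      ((lintegral_rnDeriv_le_of_renyiDiv_two_le hdiv).trans (ENNReal.ofReal_le_ofReal hexp)) hf hf1
  calc _ ≤ ∫⁻ y, f y ∂(M Y) + ENNReal.ofReal √ρ := hstep
    _ ≤ ∫⁻ y, f y ∂(M Z) + ENNReal.ofReal √ρ * k + ENNReal.ofReal √ρ := by gcongr
    _ = _ := by push_cast; ring

lemma one_sub_one_div_sqrt_two_le : 1 - 1 / √2 ≤ 8 / 27 := by
  have h1 : √2 ≤ 27 / 19 := Real.sqrt_le_iff.2 ⟨by norm_num, by norm_num⟩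
  have h2 : (19 : ℝ) / 27 ≤ 1 / √2 := by
    rw [le_div_iff₀ (by positivity)]; linarith
  linarith

/-- For `ρ ≤ 1 / 2` changing one entry costs at most `√ρ` in total variation; with the
separation `a = 2 / (3 n √ρ)` the expected cost along the coupling is `2 / 3`. -/
lemma IsZCDP.le_iSup_mechanismRisk_of_le_half {n : ℕ} {ρ : ℝ} (hnρ : 1 < n * √ρ)
    (hρ : ρ ≤ 1 / 2) {M : Kernel (Fin n → Feature) Param} [IsMarkovKernel M] (hM : IsZCDP ρ M) :
    ENNReal.ofReal (1 / (27 * (n : ℝ) ^ 2 * ρ)) ≤ ⨆ θ, mechanismRisk M θ := by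
  classical
  have hs : 0 < √ρ := by
    by_contra! h
    have := mul_nonpos_of_nonneg_of_nonpos (Nat.cast_nonneg (α := ℝ) n) h
    linarith
  have hρ0 : 0 < ρ := Real.sqrt_pos.1 hs
  set a := 2 / (3 * (n * √ρ)) with ha
  have hden : 0 < n * √ρ := by linarith
  have h0 : 0 < a := by positivity
  have h1 : a < 1 := by rw [ha, div_lt_one] <;> linarith
  set θ₁ := subParam a h0 h1 with hθ₁
  set A := ENNReal.ofReal (a ^ 2 / 2) with hA
  have hA0 : A ≠ 0 := by
    have : 0 < a ^ 2 / 2 := by positivity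
    simpa [hA] using this
  have hAtop : A ≠ ⊤ := ENNReal.ofReal_ne_top
  -- the loss at `θ₁`, truncated at `A` and normalized to take values in `[0, 1]`
  let f : Param → ℝ≥0∞ := fun y => A⁻¹ * min (ENNReal.ofReal (absDist y θ₁ ^ 2)) A
  have hf : Measurable f := ((measurable_loss θ₁).min measurable_const).const_mul _
  have hAf (y : Param) : A * f y = min (ENNReal.ofReal (absDist y θ₁ ^ 2)) A := by
    rw [← mul_assoc, ENNReal.mul_inv_cancel hA0 hAtop, one_mul]
  have hf1 (y : Param) : f y ≤ 1 := by
    rw [← ENNReal.inv_mul_cancel hA0 hAtop]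
    exact mul_le_mul_right (min_le_right _ _) _
  have hloss (y : Param) : A ≤ ENNReal.ofReal (absDist y oneParam ^ 2) + A * f y := by
    rw [hAf]
    rcases min_cases (ENNReal.ofReal (absDist y θ₁ ^ 2)) A with ⟨h, _⟩ | ⟨h, _⟩ <;> rw [h]
    · exact ofReal_le_loss_add_loss h0 h1 y
    · exact le_add_self
  have hpt (w : Fin n → Feature × Feature) :
      A ≤ ∫⁻ y, ENNReal.ofReal (absDist y oneParam ^ 2) ∂(M fun i => (w i).1)
        + ∫⁻ y, ENNReal.ofReal (absDist y θ₁ ^ 2) ∂(M fun i => resample θ₁ (w i))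
        + A * ENNReal.ofReal √ρ * (resampleCount θ₁ w : ℝ≥0∞) := by
    set μ := M fun i => (w i).1
    set ν := M fun i => resample θ₁ (w i)
    have hz := hM.lintegral_le_add hρ0 hρ hf hf1 (fun i => (w i).1) (fun i => resample θ₁ (w i))
    calc A = ∫⁻ _, A ∂μ := by simp
      _ ≤ ∫⁻ y, (ENNReal.ofReal (absDist y oneParam ^ 2) + A * f y) ∂μ := lintegral_mono hloss
      _ = ∫⁻ y, ENNReal.ofReal (absDist y oneParam ^ 2) ∂μ + A * ∫⁻ y, f y ∂μ := by
        rw [lintegral_add_left (measurable_loss _), lintegral_const_mul _ hf]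
      _ ≤ ∫⁻ y, ENNReal.ofReal (absDist y oneParam ^ 2) ∂μ
          + A * (∫⁻ y, f y ∂ν + ENNReal.ofReal √ρ * (resampleCount θ₁ w : ℝ≥0∞)) := by
        gcongr
        refine hz.trans ?_
        gcongr
        exact_mod_cast hammingDist_resample_le θ₁ w
      _ = ∫⁻ y, ENNReal.ofReal (absDist y oneParam ^ 2) ∂μ + ∫⁻ y, A * f y ∂ν
          + A * ENNReal.ofReal √ρ * (resampleCount θ₁ w : ℝ≥0∞) := by
        rw [lintegral_const_mul _ hf]; ring
      _ ≤ _ := by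
        gcongr with y
        rw [hAf]; exact min_le_left _ _
  have hcount : A * ENNReal.ofReal √ρ * ENNReal.ofReal (n * (1 - θ₁))
      = ENNReal.ofReal (a ^ 2 / 3) := by
    have : 1 - (θ₁ : ℝ) = a := by simp [hθ₁, subParam]
    rw [this, hA, ← ENNReal.ofReal_mul (by positivity), ← ENNReal.ofReal_mul (by positivity)]
    have hn0 : (n : ℝ) ≠ 0 := left_ne_zero_of_mul hden.ne'
    have h3 : n * √ρ * a = 2 / 3 := by rw [ha]; field_simp
    congr 1
    linear_combination (a ^ 2 / 2) * h3
  have hsum : ENNReal.ofReal (a ^ 2 / 6) ≤ mechanismRisk M oneParam + mechanismRisk M θ₁ := by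
    refine (ENNReal.add_le_add_iff_right (a := ENNReal.ofReal (a ^ 2 / 3))
      ENNReal.ofReal_ne_top).1 ?_
    have hmeas : Measurable fun w : Fin n → Feature × Feature =>
        (resampleCount θ₁ w : ℝ≥0∞) :=
      (measurable_of_countable _).comp (measurable_resampleCount n θ₁)
    calc ENNReal.ofReal (a ^ 2 / 6) + ENNReal.ofReal (a ^ 2 / 3)
        = ∫⁻ _, A ∂(sampleCoupling n θ₁) := by
          rw [← ENNReal.ofReal_add (by positivity) (by positivity), lintegral_const,
            measure_univ, mul_one]
          congr 1; ring
      _ ≤ _ := lintegral_mono hpt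
      _ = _ := by
        rw [lintegral_add_right _ (hmeas.const_mul _), lintegral_const_mul _ hmeas,
          lintegral_resampleCount, hcount, ← mechanismRisk_add_eq]
  refine le_trans (ENNReal.ofReal_le_ofReal (le_of_eq ?_)) (le_iSup_mechanismRisk_of_le_add hsum)
  rw [ha, div_pow, mul_pow, mul_pow, Real.sq_sqrt hρ0.le]
  field_simp; norm_num

lemma IsZCDP.le_iSup_mechanismRisk {n : ℕ} {ρ : ℝ} (hnρ : 1 < n * √ρ)
    {M : Kernel (Fin n → Feature) Param} [IsMarkovKernel M] (hM : IsZCDP ρ M) :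
    ENNReal.ofReal ((1 - 1 / √2) / (8 * (n : ℝ) ^ 2 * ρ)) ≤ ⨆ θ, mechanismRisk M θ := by
  have hc := one_sub_one_div_sqrt_two_le
  have hs : 0 < √ρ := by
    by_contra! h
    have := mul_nonpos_of_nonneg_of_nonpos (Nat.cast_nonneg (α := ℝ) n) h
    linarith
  have hρ0 : 0 < ρ := Real.sqrt_pos.1 hs
  have hn : n ≠ 0 := by
    rintro rfl
    norm_num at hnρ
  have hn0 : (0 : ℝ) < n := by exact_mod_cast Nat.pos_of_ne_zero hn
  rcases le_or_gt ρ (1 / 2) with hρ | hρ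
  · refine le_trans (ENNReal.ofReal_le_ofReal ?_) (hM.le_iSup_mechanismRisk_of_le_half hnρ hρ)
    rw [div_le_div_iff₀ (by positivity) (by positivity)]
    have : 0 < (n : ℝ) ^ 2 * ρ := by positivity
    nlinarith
  -- beyond `1 / 2` the bound is already valid without privacy
  rcases (show n = 1 ∨ 2 ≤ n by omega) with rfl | hn2
  · refine le_trans (ENNReal.ofReal_le_ofReal ?_) (ofReal_le_iSup_mechanismRisk_one M)
    have hρ1 : 1 < ρ := by
      have h1 : 1 < √ρ := by simpa using hnρ
      simpa using (Real.lt_sqrt one_pos.le).1 h1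
    rw [div_le_div_iff₀ (by positivity) (by norm_num)]
    norm_num at hc ⊢
    linarith
  · refine le_trans (ENNReal.ofReal_le_ofReal ?_) (ofReal_le_iSup_mechanismRisk_of_two_le hn2 M)
    rw [div_le_div_iff₀ (by positivity) (by positivity)]
    have : 0 < (n : ℝ) ^ 2 := by positivity
    nlinarith

/-! ### Rates -/

lemma isTheta_one_div_sq_of_le {R : ℕ → ℝ≥0∞} {c C : ℝ} (hc : 0 < c)
    (hlow : ∀ n : ℕ, 1 ≤ n → ENNReal.ofReal (c / (n : ℝ) ^ 2) ≤ R n)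
    (hupp : ∀ n : ℕ, 1 ≤ n → R n ≤ ENNReal.ofReal (C / (n : ℝ) ^ 2)) :
    (fun n : ℕ => (R n).toReal) =Θ[atTop] fun n : ℕ => 1 / (n : ℝ) ^ 2 := by
  constructor
  · refine IsBigO.of_bound |C| ?_
    filter_upwards [eventually_ge_atTop 1] with n hn
    have h1 : (R n).toReal ≤ |C| / (n : ℝ) ^ 2 := by
      refine ENNReal.toReal_le_of_le_ofReal (by positivity) ((hupp n hn).trans ?_)
      exact ENNReal.ofReal_le_ofReal (by gcongr; exact le_abs_self C)
    rw [Real.norm_of_nonneg ENNReal.toReal_nonneg, Real.norm_of_nonneg (by positivity),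
      mul_one_div]
    exact h1
  · refine IsBigO.of_bound c⁻¹ ?_
    filter_upwards [eventually_ge_atTop 1] with n hn
    have h1 : c / (n : ℝ) ^ 2 ≤ (R n).toReal :=
      (ENNReal.ofReal_le_iff_le_toReal
        (ne_top_of_le_ne_top ENNReal.ofReal_ne_top (hupp n hn))).1 (hlow n hn)
    rw [Real.norm_of_nonneg ENNReal.toReal_nonneg, Real.norm_of_nonneg (by positivity)]
    calc 1 / (n : ℝ) ^ 2 = c⁻¹ * (c / (n : ℝ) ^ 2) := by field_simp
      _ ≤ _ := by gcongr

lemma iSup_sampleMaxRisk_le {n : ℕ} (hn : 1 ≤ n) :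
    ⨆ θ : Param, sampleMaxRisk n θ ≤ ENNReal.ofReal (2 / (n : ℝ) ^ 2) := by
  refine iSup_le fun θ => (sampleMaxRisk_le hn θ).trans (ENNReal.ofReal_le_ofReal ?_)
  have h1 : (θ : ℝ) ^ 2 ≤ 1 := pow_le_one₀ θ.2.1.le θ.2.2
  gcongr
  linarith

end UniformMinimax

end

theorem mainTheorem10 :
    -- non-private lower bound, for every sample size
    (∀ n : ℕ, 1 ≤ n →
      ENNReal.ofReal (Real.exp (-1) / (8 * (n : ℝ) ^ 2)) ≤
        UniformMinimax.minimaxRisk (UniformMinimax.uniformModel n)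
          UniformMinimax.absDist (fun t => t ^ 2)) ∧
    -- the minimax risk is bounded by the worst-case risk of the sample maximum
    (∀ n : ℕ, 1 ≤ n →
      UniformMinimax.minimaxRisk (UniformMinimax.uniformModel n)
          UniformMinimax.absDist (fun t => t ^ 2) ≤
        ⨆ θ : UniformMinimax.Param, UniformMinimax.sampleMaxRisk n θ) ∧
    -- the risk of the sample maximum at `θ` is `O(θ² / n²)`
    (∃ C : ℝ, 0 < C ∧ ∀ n : ℕ, 1 ≤ n → ∀ θ : UniformMinimax.Param,
      UniformMinimax.sampleMaxRisk n θ ≤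
        ENNReal.ofReal (C * (θ : ℝ) ^ 2 / (n : ℝ) ^ 2)) ∧
    -- the minimax risk is of exact order `1 / n²`
    ((fun n : ℕ => (UniformMinimax.minimaxRisk (UniformMinimax.uniformModel n)
          UniformMinimax.absDist (fun t => t ^ 2)).toReal)
        =Θ[atTop] fun n : ℕ => 1 / (n : ℝ) ^ 2) ∧
    -- and so is the worst-case risk of the sample maximum
    ((fun n : ℕ => (⨆ θ : UniformMinimax.Param, UniformMinimax.sampleMaxRisk n θ).toReal)
        =Θ[atTop] fun n : ℕ => 1 / (n : ℝ) ^ 2) ∧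
    -- lower bound under `ε`-differential privacy
    (∀ (n : ℕ) (ε : ℝ), 1 < (n : ℝ) * ε →
      ENNReal.ofReal (Real.exp (-1) / (8 * ((n : ℝ) * ε) ^ 2)) ≤
        UniformMinimax.privateMinimaxRisk (UniformMinimax.IsDP ε 0)
          (UniformMinimax.uniformModel n) UniformMinimax.absDist (fun t => t ^ 2)) ∧
    -- lower bound under `ρ`-zero concentrated differential privacy
    (∀ (n : ℕ) (ρ : ℝ), 1 < (n : ℝ) * √ρ →
      ENNReal.ofReal ((1 - 1 / √2) / (8 * (n : ℝ) ^ 2 * ρ)) ≤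
        UniformMinimax.privateMinimaxRisk (UniformMinimax.IsZCDP ρ)
          (UniformMinimax.uniformModel n) UniformMinimax.absDist (fun t => t ^ 2)) := by
  have hlow : ∀ n : ℕ, 1 ≤ n →
      ENNReal.ofReal (Real.exp (-1) / 8 / (n : ℝ) ^ 2) ≤
        UniformMinimax.minimaxRisk (UniformMinimax.uniformModel n)
          UniformMinimax.absDist (fun t => t ^ 2) := fun n hn => by
    rw [div_div]; exact UniformMinimax.exp_div_le_minimaxRisk hn
  have hpos : 0 < Real.exp (-1) / 8 := by positivity
  refine ⟨fun n hn => UniformMinimax.exp_div_le_minimaxRisk hn,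
    fun n hn => UniformMinimax.minimaxRisk_le_iSup_sampleMaxRisk hn,
    ⟨2, two_pos, fun n hn θ => UniformMinimax.sampleMaxRisk_le hn θ⟩, ?_, ?_,
    fun n ε hnε => le_iInf fun M => le_iInf₂ fun _ hM => hM.le_iSup_mechanismRisk hnε,
    fun n ρ hnρ => le_iInf fun M => le_iInf₂ fun _ hM => hM.le_iSup_mechanismRisk hnρ⟩
  · exact UniformMinimax.isTheta_one_div_sq_of_le hpos hlow fun n hn =>
      (UniformMinimax.minimaxRisk_le_iSup_sampleMaxRisk hn).trans
        (UniformMinimax.iSup_sampleMaxRisk_le hn)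
  · exact UniformMinimax.isTheta_one_div_sq_of_le hpos
      (fun n hn => (hlow n hn).trans (UniformMinimax.minimaxRisk_le_iSup_sampleMaxRisk hn))
      fun n hn => UniformMinimax.iSup_sampleMaxRisk_le hn
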